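/- For $w\in\mathbb C\setminus\{0\}$ write $[w]=w-w^{-1}$. For $n\ge 0$, $q,b,c\in\mathbb C\setminus\{0\}$ and $\mathbf x=(x_1,\dots,x_n)$, $\mathbf y=(y_1,\dots,y_n)\in\mathbb C^n$, let $M_{UU}(\mathbf x;\mathbf y;b,c)$ be the $n\times n$ matrix with entries $$M_{ij}=\frac{[b/y_j][c x_i]}{[q x_i/y_j]}-\frac{[b/y_j][c/x_i]}{[q/(x_iy_j)]}+\frac{[b y_j][c/x_i]}{[q y_j/x_i]}-\frac{[b y_j][c x_i]}{[q x_iy_j]},$$ and let $$Z^{(2)}_{UU}(\mathbf x;\mathbf y;b,c)=\frac{\prod_{i,j=1}^n[q x_i/y_j][q y_j/x_i][q x_iy_j][q/(x_iy_j)]}{\prod_{1\le i<j\le n}[x_j/x_i][y_i/y_j]\prod_{1\le i\le j\le n}[1/(x_ix_j)][y_iy_j]}\;\det M_{UU}(\mathbf x;\mathbf y;b,c).$$ Kuperberg's polynomial $A^{(2)}_{UU}(4n;t,y,z)$ is the polynomial in the three variables $t,y,z$ determined by $$A^{(2)}_{UU}(4n;t,y,z)=\frac{[q^2]^{2n}\,Z^{(2)}_{UU}(1,\dots,1;1,\dots,1;b,c)}{[q]^{n(2n+1)}\,([b/q][c/q])^n},\qquad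 t=\Big(\frac{[q^2]}{[q]}\Big)^2,\quad y=\frac{[bq]}{[b/q]},\quad z=\frac{[cq]}{[c/q]},$$ for all non-zero $q,b,c$ with $[q],[b/q],[c/q]\neq 0$, where the value of $Z^{(2)}_{UU}$ at $\mathbf x=\mathbf y=(1,\dots,1)$ is its limit through points at which the denominator of its prefactor does not vanish. Then for every $n\ge 0$ there is exactly one such polynomial over $\mathbb C$ (in particular the limit exists), and it is given by the determinant $$A^{(2)}_{UU}(4n;t,y,z)=\det_{i,j=0}^{n-1}\Bigg[\sum_{k=0}^{n-1}\bigg\{\big(t+(1+y)(1+z)\big)\binom{i+j}{i+k}\binom{i+k}{2k}t^k+\bigg((1+z)\binom{i+j}{i+k}\binom{i+k}{2k+1}+(1+y)\binom{i+j}{i+k+1}\binom{i+k+1}{2k+1}\bigg)t^{k+1}\bigg\}\Bigg].$$ -/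

import Mathlib

open Filter Topology

noncomputable section

namespace KuperbergUU

/-- The notation `[z] = z - z⁻¹`. -/
def bracket (z : ℂ) : ℂ := z - z⁻¹

/-- The matrix `M_UU(x; y; b, c)`, at crossing parameter `q`. -/
def matrixUU {n : ℕ} (q b c : ℂ) (x y : Fin n → ℂ) : Matrix (Fin n) (Fin n) ℂ :=
  Matrix.of fun i j =>
    bracket (b / y j) * bracket (c * x i) / bracket (q * x i / y j)
      - bracket (b / y j) * bracket (c / x i) / bracket (q / (x i * y j))
      + bracket (b * y j) * bracket (c / x i) / bracket (q * y j / x i)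
      - bracket (b * y j) * bracket (c * x i) / bracket (q * x i * y j)

/-- The numerator of the prefactor of `Z_UU^(2)`. -/
def numeratorUU {n : ℕ} (q : ℂ) (x y : Fin n → ℂ) : ℂ :=
  ∏ i, ∏ j, bracket (q * x i / y j) * bracket (q * y j / x i)
    * bracket (q * x i * y j) * bracket (q / (x i * y j))

/-- The denominator of the prefactor of `Z_UU^(2)`: the product over `i < j` of
`[x_j / x_i] [y_i / y_j]` times the product over `i ≤ j` of `[1 / (x_i x_j)] [y_i y_j]`. -/
def denominatorUU {n : ℕ} (x y : Fin n → ℂ) : ℂ :=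
  (∏ i, ∏ j ∈ Finset.Ioi i, bracket (x j / x i) * bracket (y i / y j))
    * ∏ i, ∏ j ∈ Finset.Ici i, bracket (1 / (x i * x j)) * bracket (y i * y j)

/-- Kuperberg's function `Z_UU^(2)(x_1, …, x_n; y_1, …, y_n; b, c)`, as a determinant. It is a
Laurent polynomial, given by this quotient wherever the denominators do not vanish. -/
def ZUU2 {n : ℕ} (q b c : ℂ) (x y : Fin n → ℂ) : ℂ :=
  numeratorUU q x y / denominatorUU x y * (matrixUU q b c x y).det

/-- `t = ([q²] / [q])²`. -/
def tParam (q : ℂ) : ℂ := (bracket (q ^ 2) / bracket q) ^ 2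

/-- `y = [b q] / [b / q]` (and, with `c` in place of `b`, the parameter `z`). -/
def boundaryParam (q b : ℂ) : ℂ := bracket (b * q) / bracket (b / q)

/-- The polynomial `P(t, y, z)` is `A_UU^(2)(4n; t, y, z)`: for all parameters `q, b, c` for which
the expressions make sense,
`P(t, y, z) = [q²]^(2n) Z_UU^(2)(1, …, 1; 1, …, 1; b, c) / ([q]^(n(2n+1)) ([b/q] [c/q])^n)` where
`t = ([q²]/[q])²`, `y = [bq]/[b/q]`, `z = [cq]/[c/q]`. Both the numerator determinant and the
denominator of `Z_UU^(2)` vanish when all the variables are `1`, so its value there is the limit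
taken through points where the denominator is non-zero. The variables `0, 1, 2` of the
polynomial are `t, y, z`. -/
def IsAUU2 (n : ℕ) (P : MvPolynomial (Fin 3) ℂ) : Prop :=
  ∀ q b c : ℂ, q ≠ 0 → b ≠ 0 → c ≠ 0 →
    bracket q ≠ 0 → bracket (b / q) ≠ 0 → bracket (c / q) ≠ 0 →
    Tendsto
      (fun p : (Fin n → ℂ) × (Fin n → ℂ) =>
        bracket (q ^ 2) ^ (2 * n) * ZUU2 q b c p.1 p.2
          / (bracket q ^ (n * (2 * n + 1)) * (bracket (b / q) * bracket (c / q)) ^ n))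
      (𝓝[{p | denominatorUU p.1 p.2 ≠ 0}] (fun _ => 1, fun _ => 1))
      (𝓝 (MvPolynomial.eval ![tParam q, boundaryParam q b, boundaryParam q c] P))

end KuperbergUU

end

/-!
Put `u = ([y_j]/[q])²` and `v = ([x_i]/[q])²`. Up to the factors `[x_i²]` and `[y_j²]`, the entry
`M_ij` is a value of the rational function
`(α (1 - u - v) + β u + γ v) / ((1 - u - v)² - t u v)`, where `α = t + (1 + y)(1 + z)`,
`β = t (1 + z)` and `γ = t (1 + y)`, and the denominator of the prefactor of `Z_UU^(2)` is, up to
the same factors, the product of the Vandermonde determinants in the `u` and in the `v`. As all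
variables tend to `1`, all `u` and `v` tend to `0`, and for a convergent series
`f(u, v) = ∑ a_{kl} u^k v^l` the quotient of `det f(u_i, v_j)` by the two Vandermonde determinants
tends to `det a_{ij}`: in the bases of Newton polynomials over the nodes, the matrix `f(u_i, v_j)`
factors as `N_u K N_vᵀ` with `det N_u`, `det N_v` the Vandermonde determinants, and `K`, whose
entries are divided differences of `f`, tends to the matrix of Taylor coefficients even when the
nodes collide. The Taylor coefficients come from expanding
`(1 - u - v) / ((1 - u - v)² - t u v) = ∑ t^k u^k v^k / (1 - u - v)^(2k + 1)`.

The polynomial is unique because the parameters `t, y, z` of `q, b, c` cover the complement of a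
hypersurface in `ℂ³`.
-/

noncomputable section

namespace KuperbergUU

section NewtonInterpolation

variable {R : Type*} [CommRing R]

/-- The Newton polynomial `∏_{m < r} (w - u m)` over the nodes `u`, evaluated at `w`. -/
def newtonBasis (u : ℕ → R) (r : ℕ) (w : R) : R :=
  ∏ m ∈ Finset.range r, (w - u m)

/-- The coefficient of the `r`-th Newton polynomial in the expansion of `w ^ k`, that is, the
divided difference of `w ↦ w ^ k` at the nodes `u 0, …, u r`. The recursion avoids the division,
so that the nodes may coincide. -/
def newtonCoeff (u : ℕ → R) : ℕ → ℕ → R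
  | 0, 0 => 1
  | 0, _ + 1 => 0
  | k + 1, 0 => u 0 * newtonCoeff u k 0
  | k + 1, r + 1 => newtonCoeff u k r + u (r + 1) * newtonCoeff u k (r + 1)

lemma newtonBasis_node_eq_zero (u : ℕ → R) {i r : ℕ} (h : i < r) : newtonBasis u r (u i) = 0 :=
  Finset.prod_eq_zero (Finset.mem_range.2 h) (sub_self _)

lemma mul_newtonBasis (u : ℕ → R) (r : ℕ) (w : R) :
    w * newtonBasis u r w = newtonBasis u (r + 1) w + u r * newtonBasis u r w := by
  rw [newtonBasis, newtonBasis, Finset.prod_range_succ]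
  ring

lemma sum_newtonCoeff_succ_mul_newtonBasis (u : ℕ → R) (k n : ℕ) (w : R) :
    ∑ r ∈ Finset.range (n + 1), newtonCoeff u (k + 1) r * newtonBasis u r w
        + newtonCoeff u k n * newtonBasis u (n + 1) w
      = w * ∑ r ∈ Finset.range (n + 1), newtonCoeff u k r * newtonBasis u r w := by
  induction n with
  | zero =>
    simp only [zero_add, Finset.sum_range_one, newtonCoeff]
    linear_combination -newtonCoeff u k 0 * mul_newtonBasis u 0 w
  | succ n ih =>
    rw [Finset.sum_range_succ, Finset.sum_range_succ _ (n + 1), mul_add, ← ih, newtonCoeff]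
    linear_combination -newtonCoeff u k (n + 1) * mul_newtonBasis u (n + 1) w

lemma sum_newtonCoeff_mul_newtonBasis {u : ℕ → R} {n : ℕ} {w : R} (hw : newtonBasis u n w = 0)
    (k : ℕ) : ∑ r ∈ Finset.range n, newtonCoeff u k r * newtonBasis u r w = w ^ k := by
  cases n with
  | zero =>
    have : Subsingleton R := subsingleton_of_zero_eq_one (by simpa [newtonBasis] using hw.symm)
    exact Subsingleton.elim _ _
  | succ n =>
    induction k with
    | zero => simp [Finset.sum_range_succ', newtonCoeff, newtonBasis]
    | succ k ih =>
      have h := sum_newtonCoeff_succ_mul_newtonBasis u k n w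
      rwa [hw, mul_zero, add_zero, ih, ← pow_succ'] at h

lemma newtonCoeff_zero_nodes (k r : ℕ) :
    newtonCoeff (0 : ℕ → R) k r = if k = r then 1 else 0 := by
  induction k generalizing r with
  | zero => cases r <;> simp [newtonCoeff]
  | succ k ih => cases r <;> simp [newtonCoeff, ih]

lemma continuous_newtonCoeff [TopologicalSpace R] [IsTopologicalRing R] (k r : ℕ) :
    Continuous fun u : ℕ → R => newtonCoeff u k r := by
  induction k generalizing r with
  | zero => cases r <;> exact continuous_const
  | succ k ih =>
    cases r with
    | zero => exact (continuous_apply 0).mul (ih 0)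
    | succ r => exact (ih r).add ((continuous_apply (r + 1)).mul (ih (r + 1)))

lemma norm_newtonCoeff_le {𝕜 : Type*} [NormedField 𝕜] {u : ℕ → 𝕜} {ρ : ℝ} (hρ : 0 < ρ)
    (hu : ∀ m, ‖u m‖ ≤ ρ / 2) (k r : ℕ) : ‖newtonCoeff u k r‖ ≤ ρ ^ k * (2 / ρ) ^ r := by
  induction k generalizing r with
  | zero =>
    cases r with
    | zero => simp [newtonCoeff]
    | succ r => simpa [newtonCoeff] using by positivity
  | succ k ih =>
    cases r with
    | zero =>
      calc ‖u 0 * newtonCoeff u k 0‖ ≤ ρ / 2 * (ρ ^ k * (2 / ρ) ^ 0) := by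
            rw [norm_mul]; gcongr; exacts [hu 0, ih 0]
        _ ≤ ρ ^ (k + 1) * (2 / ρ) ^ 0 := by
            rw [pow_zero, mul_one, mul_one, pow_succ']
            gcongr
            exact half_le_self hρ.le
    | succ r =>
      calc ‖newtonCoeff u k r + u (r + 1) * newtonCoeff u k (r + 1)‖
          ≤ ρ ^ k * (2 / ρ) ^ r + ρ / 2 * (ρ ^ k * (2 / ρ) ^ (r + 1)) := by
            refine norm_add_le_of_le (ih r) ?_
            rw [norm_mul]; gcongr; exacts [hu _, ih _]
        _ = ρ ^ (k + 1) * (2 / ρ) ^ (r + 1) := by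
            linear_combination (-(ρ ^ k * (2 / ρ) ^ r) / 2) * mul_div_cancel₀ 2 hρ.ne'

variable {n : ℕ}

/-- The sequence of nodes `u 0, …, u (n - 1), 0, 0, …`. -/
def nodeSeq (u : Fin n → R) (m : ℕ) : R :=
  if h : m < n then u ⟨m, h⟩ else 0

@[simp]
lemma nodeSeq_val (u : Fin n → R) (i : Fin n) : nodeSeq u i = u i := by
  simp [nodeSeq]

@[simp]
lemma nodeSeq_zero : nodeSeq (0 : Fin n → R) = 0 := by
  ext m
  simp [nodeSeq]

lemma continuous_nodeSeq [TopologicalSpace R] :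
    Continuous (nodeSeq : (Fin n → R) → ℕ → R) := by
  refine continuous_pi fun m => ?_
  by_cases h : m < n
  · simpa [nodeSeq, h] using continuous_apply _
  · simpa [nodeSeq, h] using continuous_const

lemma norm_nodeSeq_le {A : Type*} [SeminormedCommRing A] (u : Fin n → A) (m : ℕ) :
    ‖nodeSeq u m‖ ≤ ‖u‖ := by
  rw [nodeSeq]
  split_ifs with h
  · exact norm_le_pi_norm u _
  · simp

lemma pow_eq_sum_newtonCoeff_mul (u : Fin n → R) (i : Fin n) (k : ℕ) :
    u i ^ k = ∑ r : Fin n, newtonCoeff (nodeSeq u) k r * newtonBasis (nodeSeq u) r (u i) := by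
  have h := newtonBasis_node_eq_zero (nodeSeq u) i.isLt
  rw [nodeSeq_val] at h
  rw [← sum_newtonCoeff_mul_newtonBasis h k, ← Fin.sum_univ_eq_sum_range]

lemma det_newtonBasis [Nontrivial R] (u : Fin n → R) :
    (Matrix.of fun i r : Fin n => newtonBasis (nodeSeq u) r (u i)).det
      = (Matrix.vandermonde u).det := by
  let p (r : Fin n) : Polynomial R :=
    ∏ m ∈ Finset.range r, (Polynomial.X - Polynomial.C (nodeSeq u m))
  have hp (r : Fin n) (w : R) : (p r).eval w = newtonBasis (nodeSeq u) r w := by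
    simp [p, newtonBasis, Polynomial.eval_prod]
  simpa only [hp] using (Matrix.det_eval_matrixOfPolynomials_eq_det_vandermonde u p
    (fun r => by simp [p])
    (fun r => Polynomial.monic_prod_of_monic _ _ fun m _ => Polynomial.monic_X_sub_C _)).symm

end NewtonInterpolation

section HomogeneousLimit

variable {𝕜 : Type*} [RCLike 𝕜] {n : ℕ}

/-- The matrix of the function `∑ a (k, l) u ^ k v ^ l` in the bases of Newton polynomials over the
nodes `u` and `v`. -/
def newtonKernel (a : ℕ × ℕ → 𝕜) (u v : Fin n → 𝕜) : Matrix (Fin n) (Fin n) 𝕜 :=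
  Matrix.of fun r s =>
    ∑' p : ℕ × ℕ, a p * newtonCoeff (nodeSeq u) p.1 r * newtonCoeff (nodeSeq v) p.2 s

lemma norm_mul_newtonCoeff_mul_newtonCoeff_le (a : ℕ × ℕ → 𝕜) {ρ : ℝ} (hρ : 0 < ρ)
    {u v : Fin n → 𝕜} (hu : ‖u‖ ≤ ρ / 2) (hv : ‖v‖ ≤ ρ / 2) (r s : ℕ) (p : ℕ × ℕ) :
    ‖a p * newtonCoeff (nodeSeq u) p.1 r * newtonCoeff (nodeSeq v) p.2 s‖
      ≤ ‖a p‖ * ρ ^ p.1 * ρ ^ p.2 * ((2 / ρ) ^ r * (2 / ρ) ^ s) := by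
  have hu' := norm_newtonCoeff_le hρ (fun m => (norm_nodeSeq_le u m).trans hu) p.1 r
  have hv' := norm_newtonCoeff_le hρ (fun m => (norm_nodeSeq_le v m).trans hv) p.2 s
  calc _ ≤ ‖a p‖ * (ρ ^ p.1 * (2 / ρ) ^ r) * (ρ ^ p.2 * (2 / ρ) ^ s) := by
        rw [norm_mul, norm_mul]; gcongr
    _ = _ := by ring

lemma tendsto_newtonKernel {a : ℕ × ℕ → 𝕜} {ρ : ℝ} (hρ : 0 < ρ)
    (ha : Summable fun p : ℕ × ℕ => ‖a p‖ * ρ ^ p.1 * ρ ^ p.2) :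
    Tendsto (fun p : (Fin n → 𝕜) × (Fin n → 𝕜) => newtonKernel a p.1 p.2) (𝓝 0)
      (𝓝 (Matrix.of fun i j : Fin n => a (i, j))) := by
  refine tendsto_pi_nhds.2 fun r => tendsto_pi_nhds.2 fun s => ?_
  have hcont (p : ℕ × ℕ) : Continuous fun w : (Fin n → 𝕜) × (Fin n → 𝕜) =>
      a p * newtonCoeff (nodeSeq w.1) p.1 r * newtonCoeff (nodeSeq w.2) p.2 s :=
    (continuous_const.mul ((continuous_newtonCoeff _ _).comp
      (continuous_nodeSeq.comp continuous_fst))).mul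
      ((continuous_newtonCoeff _ _).comp (continuous_nodeSeq.comp continuous_snd))
  have hsmall : ∀ᶠ w : (Fin n → 𝕜) × (Fin n → 𝕜) in 𝓝 0, ‖w‖ < ρ / 2 :=
    (continuous_norm.tendsto' 0 0 norm_zero).eventually_lt_const (by positivity)
  have hlim := tendsto_tsum_of_dominated_convergence
    (ha.mul_right ((2 / ρ) ^ (r : ℕ) * (2 / ρ) ^ (s : ℕ))) (fun p => (hcont p).tendsto 0)
    (by
      filter_upwards [hsmall] with w hw p
      exact norm_mul_newtonCoeff_mul_newtonCoeff_le a hρ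
        ((norm_fst_le w).trans hw.le) ((norm_snd_le w).trans hw.le) r s p)
  have hzero : ∑' p : ℕ × ℕ, a p * newtonCoeff (nodeSeq (0 : Fin n → 𝕜)) p.1 r
      * newtonCoeff (nodeSeq (0 : Fin n → 𝕜)) p.2 s = a (r, s) := by
    rw [tsum_eq_single ((r : ℕ), (s : ℕ))]
    · simp [newtonCoeff_zero_nodes]
    · rintro ⟨k, l⟩ hkl
      simp only [nodeSeq_zero, newtonCoeff_zero_nodes]
      split_ifs with hk hl <;> simp_all
  rw [Prod.fst_zero, Prod.snd_zero, hzero] at hlim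
  exact hlim

lemma det_of_hasSum_eq_mul_det_newtonKernel {a : ℕ × ℕ → 𝕜} {f : 𝕜 → 𝕜 → 𝕜} {ρ : ℝ}
    (hρ : 0 < ρ) (ha : Summable fun p : ℕ × ℕ => ‖a p‖ * ρ ^ p.1 * ρ ^ p.2) {u v : Fin n → 𝕜}
    (hu : ‖u‖ ≤ ρ / 2) (hv : ‖v‖ ≤ ρ / 2)
    (hf : ∀ i j, HasSum (fun p : ℕ × ℕ => a p * u i ^ p.1 * v j ^ p.2) (f (u i) (v j))) :
    (Matrix.of fun i j => f (u i) (v j)).det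
      = (Matrix.vandermonde u).det * (Matrix.vandermonde v).det * (newtonKernel a u v).det := by
  have hfactor : (Matrix.of fun i j => f (u i) (v j))
      = (Matrix.of fun i r : Fin n => newtonBasis (nodeSeq u) r (u i)) * newtonKernel a u v
        * (Matrix.of fun j s : Fin n => newtonBasis (nodeSeq v) s (v j)).transpose := by
    ext i j
    have hsum (r s : Fin n) : HasSum
        (fun p : ℕ × ℕ => newtonBasis (nodeSeq u) r (u i)
          * (a p * newtonCoeff (nodeSeq u) p.1 r * newtonCoeff (nodeSeq v) p.2 s)
          * newtonBasis (nodeSeq v) s (v j))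
        (newtonBasis (nodeSeq u) r (u i) * newtonKernel a u v r s
          * newtonBasis (nodeSeq v) s (v j)) :=
      ((Summable.of_norm_bounded (ha.mul_right _)
        (norm_mul_newtonCoeff_mul_newtonCoeff_le a hρ hu hv r s)).hasSum.mul_left _).mul_right _
    have hexp := hasSum_sum fun s (_ : s ∈ Finset.univ) => hasSum_sum
      fun r (_ : r ∈ Finset.univ) => hsum r s
    simp only [Matrix.mul_apply, Matrix.transpose_apply, Matrix.of_apply, Finset.sum_mul]
    refine (hf i j).unique ?_
    refine hexp.congr_fun fun p => ?_
    rw [pow_eq_sum_newtonCoeff_mul u i, pow_eq_sum_newtonCoeff_mul v j, Finset.mul_sum]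
    refine Finset.sum_congr rfl fun s _ => ?_
    rw [Finset.mul_sum, Finset.sum_mul]
    exact Finset.sum_congr rfl fun r _ => by ring
  rw [hfactor, Matrix.det_mul, Matrix.det_mul, Matrix.det_transpose, det_newtonBasis,
    det_newtonBasis]
  ring

theorem tendsto_det_div_det_vandermonde {a : ℕ × ℕ → 𝕜} {f : 𝕜 → 𝕜 → 𝕜}
    (hf : ∀ᶠ w : 𝕜 × 𝕜 in 𝓝 0,
      HasSum (fun p : ℕ × ℕ => a p * w.1 ^ p.1 * w.2 ^ p.2) (f w.1 w.2)) :
    Tendsto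
      (fun p : (Fin n → 𝕜) × (Fin n → 𝕜) => (Matrix.of fun i j => f (p.1 i) (p.2 j)).det
        / ((Matrix.vandermonde p.1).det * (Matrix.vandermonde p.2).det))
      (𝓝[{p | (Matrix.vandermonde p.1).det * (Matrix.vandermonde p.2).det ≠ 0}] 0)
      (𝓝 (Matrix.of fun i j : Fin n => a (i, j)).det) := by
  obtain ⟨ε, hε, hball⟩ := Metric.eventually_nhds_iff_ball.1 hf
  have hρ : 0 < ε / 2 := by positivity
  have ha : Summable fun p : ℕ × ℕ => ‖a p‖ * (ε / 2) ^ p.1 * (ε / 2) ^ p.2 := by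
    have h := hball (((ε / 2 : ℝ) : 𝕜), ((ε / 2 : ℝ) : 𝕜)) (by
      simpa [Prod.norm_def, abs_of_pos hε] using hε)
    refine (summable_norm_iff.2 h.summable).congr fun p => ?_
    simp [abs_of_pos hε]
  have hlim := ((continuous_id.matrix_det.tendsto _).comp
    (tendsto_newtonKernel (n := n) hρ ha)).mono_left (nhdsWithin_le_nhds
      (s := {p | (Matrix.vandermonde p.1).det * (Matrix.vandermonde p.2).det ≠ 0}))
  refine hlim.congr' ?_
  have hsmall : ∀ᶠ w : (Fin n → 𝕜) × (Fin n → 𝕜) in 𝓝 0, ‖w‖ < ε / 2 / 2 :=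
    (continuous_norm.tendsto' 0 0 norm_zero).eventually_lt_const (by positivity)
  filter_upwards [nhdsWithin_le_nhds hsmall, self_mem_nhdsWithin] with w hw hdet
  have hu := (norm_fst_le w).trans hw.le
  have hv := (norm_snd_le w).trans hw.le
  rw [det_of_hasSum_eq_mul_det_newtonKernel hρ ha hu hv fun i j => hball (w.1 i, w.2 j) ?_]
  · exact (mul_div_cancel_left₀ _ hdet).symm
  · have h1 := (norm_le_pi_norm w.1 i).trans hu
    have h2 := (norm_le_pi_norm w.2 j).trans hv
    rw [mem_ball_zero_iff, Prod.norm_def]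
    exact max_lt (by linarith) (by linarith)

end HomogeneousLimit

section GeometricSeries

lemma hasSum_prod_of_hasSum_norm {α β E : Type*} [NormedAddCommGroup E] [CompleteSpace E]
    {f : α × β → E} {g : α → E} {G : α → ℝ} {S : E}
    (hnorm : ∀ x, HasSum (fun y => ‖f (x, y)‖) (G x)) (hG : Summable G)
    (hfiber : ∀ x, HasSum (fun y => f (x, y)) (g x)) (hg : HasSum g S) : HasSum f S := by
  have hf : Summable f := by
    refine Summable.of_norm ((summable_prod_of_nonneg fun _ => norm_nonneg _).2
      ⟨fun x => (hnorm x).summable, ?_⟩)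
    simpa only [(hnorm _).tsum_eq] using hG
  rw [hg.unique (hf.hasSum.prod_fiberwise hfiber)]
  exact hf.hasSum

variable {𝕜 : Type*} [RCLike 𝕜]

lemma hasSum_choose_add_mul_pow {x : 𝕜} (hx : ‖x‖ < 1) (i l : ℕ) :
    HasSum (fun j : ℕ => ((j + i).choose (l + i) : 𝕜) * x ^ j) (x ^ l / (1 - x) ^ (l + i + 1)) := by
  rw [← hasSum_nat_add_iff' l]
  have hinit : ∑ j ∈ Finset.range l, ((j + i).choose (l + i) : 𝕜) * x ^ j = 0 :=
    Finset.sum_eq_zero fun j hj => by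
      rw [Nat.choose_eq_zero_of_lt (by simpa using hj), Nat.cast_zero, zero_mul]
  rw [hinit, sub_zero, ← mul_one_div]
  refine ((hasSum_choose_mul_geometric_of_norm_lt_one (l + i) hx).mul_left (x ^ l)).congr_fun
    fun j => ?_
  rw [add_assoc]
  ring

/-- The coefficient of `u ^ p.1 * v ^ p.2` in `u ^ k * v ^ l / (1 - u - v) ^ (k + l + 1)`. -/
def geomCoeff (k l : ℕ) (p : ℕ × ℕ) : ℕ :=
  (p.2 + p.1).choose (l + p.1) * (p.1 + l).choose (k + l)

lemma geomCoeff_eq_zero_of_lt {k l : ℕ} {p : ℕ × ℕ} (h : p.1 < k) : geomCoeff k l p = 0 := by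
  rw [geomCoeff, Nat.choose_eq_zero_of_lt (show p.1 + l < k + l by omega), mul_zero]

lemma hasSum_geomCoeff_row (k l i : ℕ) (u : 𝕜) {v : 𝕜} (hv : ‖v‖ < 1) :
    HasSum (fun j => (geomCoeff k l (i, j) : 𝕜) * u ^ i * v ^ j)
      (((i + l).choose (k + l) : 𝕜) * (u / (1 - v)) ^ i * (v ^ l / (1 - v) ^ (l + 1))) := by
  have hvalue : ((i + l).choose (k + l) : 𝕜) * (u / (1 - v)) ^ i * (v ^ l / (1 - v) ^ (l + 1))
      = ((i + l).choose (k + l) : 𝕜) * u ^ i * (v ^ l / (1 - v) ^ (l + i + 1)) := by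
    generalize 1 - v = s
    ring
  rw [hvalue]
  refine ((hasSum_choose_add_mul_pow hv i l).mul_left _).congr_fun fun j => ?_
  simp only [geomCoeff, Nat.cast_mul]
  ring

lemma hasSum_geomCoeff_rows (k l : ℕ) {u v : 𝕜} (huv : ‖u‖ + ‖v‖ < 1) :
    HasSum (fun i : ℕ =>
        ((i + l).choose (k + l) : 𝕜) * (u / (1 - v)) ^ i * (v ^ l / (1 - v) ^ (l + 1)))
      (u ^ k * v ^ l / (1 - u - v) ^ (k + l + 1)) := by
  have hlt : ‖u‖ < ‖1 - v‖ := by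
    have := norm_sub_norm_le 1 v
    rw [norm_one] at this
    linarith
  have hv : 1 - v ≠ 0 := norm_pos_iff.1 ((norm_nonneg u).trans_lt hlt)
  have hw : ‖u / (1 - v)‖ < 1 := by
    rwa [norm_div, div_lt_one (norm_pos_iff.2 hv)]
  have hsub : 1 - u / (1 - v) = (1 - u - v) / (1 - v) := by
    field_simp
    ring
  have hvalue : u ^ k * v ^ l / (1 - u - v) ^ (k + l + 1)
      = (u / (1 - v)) ^ k / (1 - u / (1 - v)) ^ (k + l + 1) * (v ^ l / (1 - v) ^ (l + 1)) := by
    rw [hsub, div_pow, div_pow]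
    field_simp
    ring
  rw [hvalue]
  exact (hasSum_choose_add_mul_pow hw l k).mul_right _

lemma hasSum_norm_geomCoeff (k l : ℕ) {u v : 𝕜} (huv : ‖u‖ + ‖v‖ < 1) :
    HasSum (fun p : ℕ × ℕ => ‖(geomCoeff k l p : 𝕜) * u ^ p.1 * v ^ p.2‖)
      (‖u‖ ^ k * ‖v‖ ^ l / (1 - ‖u‖ - ‖v‖) ^ (k + l + 1)) := by
  have hv : ‖(‖v‖)‖ < 1 := by
    rw [norm_norm]
    linarith [norm_nonneg u]
  have huv' : ‖(‖u‖)‖ + ‖(‖v‖)‖ < 1 := by simpa only [norm_norm] using huv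
  have hrow (i : ℕ) := hasSum_geomCoeff_row k l i ‖u‖ hv
  have hrows := hasSum_geomCoeff_rows k l huv'
  simp only [norm_mul, norm_pow, RCLike.norm_natCast]
  refine hasSum_prod_of_hasSum_norm (fun i => ?_) hrows.summable hrow hrows
  simpa only [norm_mul, norm_pow, norm_norm, RCLike.norm_natCast] using hrow i

lemma hasSum_geomCoeff (k l : ℕ) {u v : 𝕜} (huv : ‖u‖ + ‖v‖ < 1) :
    HasSum (fun p : ℕ × ℕ => (geomCoeff k l p : 𝕜) * u ^ p.1 * v ^ p.2)
      (u ^ k * v ^ l / (1 - u - v) ^ (k + l + 1)) := by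
  have hs := (hasSum_norm_geomCoeff k l huv).summable
  have hv : ‖v‖ < 1 := by linarith [norm_nonneg u]
  have hsum := hs.of_norm.hasSum
  rwa [(hsum.prod_fiberwise fun i => hasSum_geomCoeff_row k l i u hv).unique
    (hasSum_geomCoeff_rows k l huv)] at hsum

lemma hasSum_pow_mul_div_pow (a b : ℕ) {t u v s : 𝕜} (hs : s ≠ 0)
    (h : ‖t * u * v‖ < ‖s ^ 2‖) :
    HasSum (fun k : ℕ => t ^ k * (u ^ (k + a) * v ^ (k + b) / s ^ (k + a + (k + b) + 1)))
      (u ^ a * v ^ b / s ^ (a + b) * (s / (s ^ 2 - t * u * v))) := by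
  have hr : ‖t * u * v / s ^ 2‖ < 1 := by
    rwa [norm_div, div_lt_one (norm_pos_iff.2 (pow_ne_zero 2 hs))]
  have hvalue : u ^ a * v ^ b / s ^ (a + b) * (s / (s ^ 2 - t * u * v))
      = u ^ a * v ^ b / s ^ (a + b + 1) * (1 - t * u * v / s ^ 2)⁻¹ := by
    rw [one_sub_div (pow_ne_zero 2 hs), inv_div]
    field_simp
    ring
  rw [hvalue]
  refine ((hasSum_geometric_of_norm_lt_one hr).mul_left _).congr_fun fun k => ?_
  rw [div_pow]
  field_simp
  ring

lemma one_sub_norm_sub_norm_le (u v : 𝕜) : 1 - ‖u‖ - ‖v‖ ≤ ‖1 - u - v‖ := by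
  have h1 := norm_sub_norm_le 1 u
  have h2 := norm_sub_norm_le (1 - u) v
  rw [norm_one] at h1
  linarith

lemma hasSum_sum_geomCoeff (a b : ℕ) {t u v : 𝕜} (huv : ‖u‖ + ‖v‖ < 1)
    (ht : ‖t‖ * ‖u‖ * ‖v‖ < (1 - ‖u‖ - ‖v‖) ^ 2) :
    HasSum (fun p : ℕ × ℕ => (∑ k ∈ Finset.range (p.1 + 1),
        t ^ k * (geomCoeff (k + a) (k + b) p : 𝕜)) * u ^ p.1 * v ^ p.2)
      (u ^ a * v ^ b / (1 - u - v) ^ (a + b) * ((1 - u - v) / ((1 - u - v) ^ 2 - t * u * v))) := by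
  have hs : 0 < 1 - ‖u‖ - ‖v‖ := by linarith
  have hle := one_sub_norm_sub_norm_le u v
  have hlt : ‖t * u * v‖ < ‖(1 - u - v) ^ 2‖ := by
    rw [norm_mul, norm_mul, norm_pow]
    exact ht.trans_le (by gcongr)
  have hseries := hasSum_prod_of_hasSum_norm
    (f := fun x : ℕ × (ℕ × ℕ) =>
      t ^ x.1 * ((geomCoeff (x.1 + a) (x.1 + b) x.2 : 𝕜) * u ^ x.2.1 * v ^ x.2.2))
    (fun k => by
      simpa only [norm_mul, norm_pow] using
        (hasSum_norm_geomCoeff (k + a) (k + b) huv).mul_left (‖t‖ ^ k))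
    (hasSum_pow_mul_div_pow a b hs.ne' (by simpa [abs_of_pos hs] using ht)).summable
    (fun k => (hasSum_geomCoeff (k + a) (k + b) huv).mul_left (t ^ k))
    (hasSum_pow_mul_div_pow a b (norm_pos_iff.1 (hs.trans_le hle)) hlt)
  refine ((Equiv.prodComm _ _).hasSum_iff.2 hseries).prod_fiberwise fun p => ?_
  simp only [Finset.sum_mul, Function.comp_apply, Equiv.prodComm_apply, Prod.swap_prod_mk,
    mul_assoc]
  refine hasSum_sum_of_ne_finset_zero fun k hk => ?_
  rw [Finset.mem_range, not_lt] at hk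
  simp [geomCoeff_eq_zero_of_lt (show p.1 < k + a by omega)]

/-- The quadratic polynomial `(1 - u - v) ^ 2 - t u v`. -/
def kernelDenom {R : Type*} [CommRing R] (t u v : R) : R :=
  (1 - u - v) ^ 2 - t * u * v

/-- The rational function with denominator `kernelDenom t u v` to which the entries of `M_UU`
reduce. -/
def kernel {K : Type*} [Field K] (t α β γ u v : K) : K :=
  (α * (1 - u - v) + β * u + γ * v) / kernelDenom t u v

/-- The coefficient of `u ^ p.1 * v ^ p.2` in `kernel t α β γ u v`. -/
def kernelCoeff {R : Type*} [CommRing R] (t α β γ : R) (p : ℕ × ℕ) : R :=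
  ∑ k ∈ Finset.range (p.1 + 1), (α * geomCoeff k k p + β * geomCoeff (k + 1) k p
    + γ * geomCoeff k (k + 1) p) * t ^ k

lemma hasSum_kernelCoeff (α β γ : 𝕜) {t u v : 𝕜} (huv : ‖u‖ + ‖v‖ < 1)
    (ht : ‖t‖ * ‖u‖ * ‖v‖ < (1 - ‖u‖ - ‖v‖) ^ 2) :
    HasSum (fun p : ℕ × ℕ => kernelCoeff t α β γ p * u ^ p.1 * v ^ p.2)
      (kernel t α β γ u v) := by
  have hs : 1 - u - v ≠ 0 :=
    norm_pos_iff.1 ((by linarith : 0 < 1 - ‖u‖ - ‖v‖).trans_le (one_sub_norm_sub_norm_le u v))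
  have hvalue : kernel t α β γ u v
      = α * (u ^ 0 * v ^ 0 / (1 - u - v) ^ (0 + 0) * ((1 - u - v) / ((1 - u - v) ^ 2 - t * u * v)))
        + β * (u ^ 1 * v ^ 0 / (1 - u - v) ^ (1 + 0)
          * ((1 - u - v) / ((1 - u - v) ^ 2 - t * u * v)))
        + γ * (u ^ 0 * v ^ 1 / (1 - u - v) ^ (0 + 1)
          * ((1 - u - v) / ((1 - u - v) ^ 2 - t * u * v))) := by
    rw [kernel, kernelDenom]
    field_simp
    ring
  rw [hvalue]
  refine ((((hasSum_sum_geomCoeff 0 0 huv ht).mul_left α).add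
    ((hasSum_sum_geomCoeff 1 0 huv ht).mul_left β)).add
    ((hasSum_sum_geomCoeff 0 1 huv ht).mul_left γ)).congr_fun fun p => ?_
  simp only [kernelCoeff, add_zero, Finset.sum_mul, Finset.mul_sum, ← Finset.sum_add_distrib]
  exact Finset.sum_congr rfl fun k _ => by ring

lemma eventually_hasSum_kernelCoeff (t α β γ : 𝕜) :
    ∀ᶠ w : 𝕜 × 𝕜 in 𝓝 0,
      HasSum (fun p : ℕ × ℕ => kernelCoeff t α β γ p * w.1 ^ p.1 * w.2 ^ p.2)
        (kernel t α β γ w.1 w.2) := by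
  have huv : ∀ᶠ w : 𝕜 × 𝕜 in 𝓝 0, ‖w.1‖ + ‖w.2‖ < 1 := by
    refine ContinuousAt.eventually_lt ?_ continuousAt_const ?_
    · fun_prop
    · simp
  have ht : ∀ᶠ w : 𝕜 × 𝕜 in 𝓝 0, ‖t‖ * ‖w.1‖ * ‖w.2‖ < (1 - ‖w.1‖ - ‖w.2‖) ^ 2 := by
    refine ContinuousAt.eventually_lt ?_ ?_ ?_
    · fun_prop
    · fun_prop
    · simp
  filter_upwards [huv, ht] with w hw₁ hw₂
  exact hasSum_kernelCoeff α β γ hw₁ hw₂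

end GeometricSeries

section Brackets

variable {q b c : ℂ}

/-- The variable `[w]² / [q]²`, in which the entries of `M_UU` become rational functions that are
regular at the origin. -/
def scaledSq (q w : ℂ) : ℂ := (bracket w / bracket q) ^ 2

/-- The function `f` for which the `(i, j)` entry of `M_UU` is proportional to
`f (scaledSq q (y j)) (scaledSq q (x i))`. -/
def kernelUU (q b c : ℂ) : ℂ → ℂ → ℂ :=
  kernel (tParam q) (tParam q + (1 + boundaryParam q b) * (1 + boundaryParam q c))
    (tParam q * (1 + boundaryParam q c)) (tParam q * (1 + boundaryParam q b))

lemma bracket_one : bracket 1 = 0 := by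
  simp [bracket]

lemma bracket_inv (w : ℂ) : bracket w⁻¹ = -bracket w := by
  simp [bracket]

lemma bracket_sq (hq : q ≠ 0) : bracket (q ^ 2) = bracket q * (q + q⁻¹) := by
  simp only [bracket]
  field_simp
  ring

lemma tParam_eq (hq : q ≠ 0) (hs : bracket q ≠ 0) : tParam q = (q + q⁻¹) ^ 2 := by
  rw [tParam, bracket_sq hq, mul_div_cancel_left₀ _ hs]

lemma one_add_boundaryParam (hq : q ≠ 0) (hb : b ≠ 0) (hbq : bracket (b / q) ≠ 0) :
    1 + boundaryParam q b = bracket b * (q + q⁻¹) / bracket (b / q) := by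
  rw [boundaryParam, eq_div_iff hbq, add_mul, div_mul_cancel₀ _ hbq]
  simp only [bracket]
  field_simp
  ring

lemma bracket_div_mul_bracket_mul {w₁ w₂ : ℂ} (hs : bracket q ≠ 0) (h₁ : w₁ ≠ 0) (h₂ : w₂ ≠ 0) :
    bracket (w₂ / w₁) * bracket (w₁ * w₂)
      = bracket q ^ 2 * (scaledSq q w₂ - scaledSq q w₁) := by
  have hscaled : bracket q ^ 2 * (scaledSq q w₂ - scaledSq q w₁)
      = bracket w₂ ^ 2 - bracket w₁ ^ 2 := by
    rw [scaledSq, scaledSq]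
    field_simp
  rw [hscaled]
  simp only [bracket]
  field_simp
  ring

variable {x y : ℂ}

lemma prod_bracket_eq (hq : q ≠ 0) (hs : bracket q ≠ 0) (hx : x ≠ 0) (hy : y ≠ 0) :
    bracket (q * x / y) * bracket (q * y / x) * bracket (q * x * y) * bracket (q / (x * y))
      = bracket q ^ 4 * kernelDenom (tParam q) (scaledSq q y) (scaledSq q x) := by
  have hscaled : bracket q ^ 4 * kernelDenom (tParam q) (scaledSq q y) (scaledSq q x)
      = (bracket q ^ 2 - bracket y ^ 2 - bracket x ^ 2) ^ 2
        - (q + q⁻¹) ^ 2 * bracket y ^ 2 * bracket x ^ 2 := by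
    rw [kernelDenom, tParam_eq hq hs, scaledSq, scaledSq]
    field_simp
  rw [hscaled]
  simp only [bracket]
  field_simp
  ring

lemma matrixUU_entry_cleared (hq : q ≠ 0) (hb : b ≠ 0) (hc : c ≠ 0) (hx : x ≠ 0) (hy : y ≠ 0) :
    bracket q * (bracket (b / y) * bracket (c * x) * (bracket (q * y / x) * bracket (q * x * y)
          * bracket (q / (x * y)))
        - bracket (b / y) * bracket (c / x) * (bracket (q * x / y) * bracket (q * y / x)
          * bracket (q * x * y))
        + bracket (b * y) * bracket (c / x) * (bracket (q * x / y) * bracket (q * x * y)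
          * bracket (q / (x * y)))
        - bracket (b * y) * bracket (c * x) * (bracket (q * x / y) * bracket (q * y / x)
          * bracket (q / (x * y))))
      = -(bracket (x ^ 2) * bracket (y ^ 2)
        * ((bracket (b / q) * bracket (c / q) + bracket b * bracket c)
            * (bracket q ^ 2 - bracket y ^ 2 - bracket x ^ 2)
          + bracket c * (q + q⁻¹) * bracket (b / q) * bracket y ^ 2
          + bracket b * (q + q⁻¹) * bracket (c / q) * bracket x ^ 2)) := by
  simp only [bracket]
  field_simp
  ring

lemma kernelUU_mul_kernelDenom (hq : q ≠ 0) (hb : b ≠ 0) (hc : c ≠ 0) (hs : bracket q ≠ 0)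
    (hbq : bracket (b / q) ≠ 0) (hcq : bracket (c / q) ≠ 0)
    (hD : kernelDenom (tParam q) (scaledSq q y) (scaledSq q x) ≠ 0) :
    bracket q ^ 2 * (bracket (b / q) * bracket (c / q))
        * (kernelUU q b c (scaledSq q y) (scaledSq q x)
          * kernelDenom (tParam q) (scaledSq q y) (scaledSq q x))
      = (q + q⁻¹) ^ 2 * ((bracket (b / q) * bracket (c / q) + bracket b * bracket c)
            * (bracket q ^ 2 - bracket y ^ 2 - bracket x ^ 2)
          + bracket c * (q + q⁻¹) * bracket (b / q) * bracket y ^ 2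
          + bracket b * (q + q⁻¹) * bracket (c / q) * bracket x ^ 2) := by
  rw [kernelUU, kernel, div_mul_cancel₀ _ hD, one_add_boundaryParam hq hb hbq,
    one_add_boundaryParam hq hc hcq, tParam_eq hq hs, scaledSq, scaledSq]
  field_simp

variable {n : ℕ} {x y : Fin n → ℂ}

lemma matrixUU_apply_mul_kernelDenom (hq : q ≠ 0) (hb : b ≠ 0) (hc : c ≠ 0) (hs : bracket q ≠ 0)
    {i j : Fin n} (hx : x i ≠ 0) (hy : y j ≠ 0)
    (hD : kernelDenom (tParam q) (scaledSq q (y j)) (scaledSq q (x i)) ≠ 0) :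
    bracket q ^ 5 * (matrixUU q b c x y i j
        * kernelDenom (tParam q) (scaledSq q (y j)) (scaledSq q (x i)))
      = -(bracket (x i ^ 2) * bracket (y j ^ 2)
        * ((bracket (b / q) * bracket (c / q) + bracket b * bracket c)
            * (bracket q ^ 2 - bracket (y j) ^ 2 - bracket (x i) ^ 2)
          + bracket c * (q + q⁻¹) * bracket (b / q) * bracket (y j) ^ 2
          + bracket b * (q + q⁻¹) * bracket (c / q) * bracket (x i) ^ 2)) := by
  have hprod := prod_bracket_eq hq hs hx hy
  have hne := mul_ne_zero (pow_ne_zero 4 hs) hD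
  rw [← hprod] at hne
  simp only [mul_ne_zero_iff] at hne
  obtain ⟨⟨⟨h₁, h₂⟩, h₃⟩, h₄⟩ := hne
  have hclear {a₁ a₂ a₃ a₄ p₁ p₂ p₃ p₄ : ℂ} (h₁ : p₁ ≠ 0) (h₂ : p₂ ≠ 0) (h₃ : p₃ ≠ 0)
      (h₄ : p₄ ≠ 0) : (a₁ / p₁ - a₄ / p₄ + a₂ / p₂ - a₃ / p₃) * (p₁ * p₂ * p₃ * p₄)
        = a₁ * (p₂ * p₃ * p₄) - a₄ * (p₁ * p₂ * p₃) + a₂ * (p₁ * p₃ * p₄)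
          - a₃ * (p₁ * p₂ * p₄) := by
    field_simp
  rw [← matrixUU_entry_cleared hq hb hc hx hy, ← hclear h₁ h₂ h₃ h₄, hprod, matrixUU,
    Matrix.of_apply]
  ring

lemma matrixUU_apply_eq (hq : q ≠ 0) (hb : b ≠ 0) (hc : c ≠ 0) (hs : bracket q ≠ 0)
    (hbq : bracket (b / q) ≠ 0) (hcq : bracket (c / q) ≠ 0) {i j : Fin n} (hx : x i ≠ 0)
    (hy : y j ≠ 0) (hD : kernelDenom (tParam q) (scaledSq q (y j)) (scaledSq q (x i)) ≠ 0) :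
    bracket (q ^ 2) ^ 2 * bracket q * matrixUU q b c x y i j
      = -(bracket (x i ^ 2) * bracket (y j ^ 2)) * (bracket (b / q) * bracket (c / q))
        * kernelUU q b c (scaledSq q (y j)) (scaledSq q (x i)) := by
  have hM := matrixUU_apply_mul_kernelDenom hq hb hc hs hx hy hD
  have hK := kernelUU_mul_kernelDenom hq hb hc hs hbq hcq hD
  refine mul_left_cancel₀ (mul_ne_zero (pow_ne_zero 2 hs) hD) ?_
  rw [bracket_sq hq]
  linear_combination (q + q⁻¹) ^ 2 * hM + bracket (x i ^ 2) * bracket (y j ^ 2) * hK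

end Brackets

section PartitionFunction

variable {n : ℕ} {q b c : ℂ} {x y : Fin n → ℂ}

lemma sq_prod_Ioi_const {R : Type*} [CommMonoid R] (a : R) :
    (∏ i : Fin n, ∏ _j ∈ Finset.Ioi i, a) ^ 2 = a ^ (n * (n - 1)) := by
  simp only [Finset.prod_const, Fin.card_Ioi, Finset.prod_pow_eq_pow_sum]
  rw [Fin.sum_univ_eq_sum_range (fun i => n - 1 - i), Finset.sum_range_reflect (fun i => i),
    ← pow_mul, Finset.sum_range_id_mul_two]

lemma denominatorUU_eq (hs : bracket q ≠ 0) (hx : ∀ i, x i ≠ 0) (hy : ∀ i, y i ≠ 0) :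
    denominatorUU x y = (∏ i, -(bracket (x i ^ 2) * bracket (y i ^ 2)))
      * bracket q ^ (2 * (n * (n - 1)))
      * ((Matrix.vandermonde fun i => scaledSq q (y i)).det
        * (Matrix.vandermonde fun i => scaledSq q (x i)).det) := by
  rw [pow_mul, ← sq_prod_Ioi_const (n := n) (bracket q ^ 2), sq]
  simp only [denominatorUU, Matrix.det_vandermonde, ← Finset.prod_Ioi_mul_eq_prod_Ici,
    ← Finset.prod_mul_distrib]
  refine Finset.prod_congr rfl fun i _ => ?_
  rw [← mul_assoc, ← Finset.prod_mul_distrib, mul_comm,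
    mul_assoc (-(bracket (x i ^ 2) * bracket (y i ^ 2))), ← Finset.prod_mul_distrib]
  congr 1
  · rw [one_div, bracket_inv, ← sq, ← sq, neg_mul]
  · refine Finset.prod_congr rfl fun j _ => ?_
    have hxij := bracket_div_mul_bracket_mul hs (hx i) (hx j)
    have hyij := bracket_div_mul_bracket_mul hs (hy i) (hy j)
    rw [one_div, bracket_inv, ← inv_div (y j), bracket_inv]
    linear_combination bracket (y j / y i) * bracket (y i * y j) * hxij
      + bracket q ^ 2 * (scaledSq q (x j) - scaledSq q (x i)) * hyij

lemma numeratorUU_eq (hq : q ≠ 0) (hs : bracket q ≠ 0) (hx : ∀ i, x i ≠ 0) (hy : ∀ i, y i ≠ 0) :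
    numeratorUU q x y = bracket q ^ (4 * (n * n))
      * ∏ i, ∏ j, kernelDenom (tParam q) (scaledSq q (y j)) (scaledSq q (x i)) := by
  simp only [numeratorUU, prod_bracket_eq hq hs (hx _) (hy _)]
  simp only [Finset.prod_mul_distrib, Finset.prod_const, Finset.card_univ, Fintype.card_fin,
    ← pow_mul, mul_assoc]

lemma det_matrixUU_eq (hq : q ≠ 0) (hb : b ≠ 0) (hc : c ≠ 0) (hs : bracket q ≠ 0)
    (hbq : bracket (b / q) ≠ 0) (hcq : bracket (c / q) ≠ 0) (hx : ∀ i, x i ≠ 0)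
    (hy : ∀ i, y i ≠ 0)
    (hD : ∀ i j, kernelDenom (tParam q) (scaledSq q (y j)) (scaledSq q (x i)) ≠ 0) :
    (bracket (q ^ 2) ^ 2 * bracket q) ^ n * (matrixUU q b c x y).det
      = (∏ i, -(bracket (x i ^ 2) * bracket (y i ^ 2)))
        * (bracket (b / q) * bracket (c / q)) ^ n
        * (Matrix.of fun i j => kernelUU q b c (scaledSq q (y i)) (scaledSq q (x j))).det := by
  have hfactor : (bracket (q ^ 2) ^ 2 * bracket q) • matrixUU q b c x y
      = (bracket (b / q) * bracket (c / q)) •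
        (Matrix.diagonal (fun i => -bracket (x i ^ 2))
          * (Matrix.of fun i j => kernelUU q b c (scaledSq q (y i)) (scaledSq q (x j))).transpose
          * Matrix.diagonal (fun j => bracket (y j ^ 2))) := by
    ext i j
    simp only [Matrix.smul_apply, smul_eq_mul, Matrix.mul_diagonal, Matrix.diagonal_mul,
      Matrix.transpose_apply, Matrix.of_apply]
    rw [matrixUU_apply_eq hq hb hc hs hbq hcq (hx i) (hy j) (hD i j)]
    ring
  have hdet := congrArg Matrix.det hfactor
  rw [Matrix.det_smul, Matrix.det_smul, Matrix.det_mul, Matrix.det_mul, Matrix.det_transpose,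
    Matrix.det_diagonal, Matrix.det_diagonal, Fintype.card_fin] at hdet
  simp only [hdet, ← neg_mul, Finset.prod_mul_distrib]
  ring

lemma normalized_ZUU2_eq (hq : q ≠ 0) (hb : b ≠ 0) (hc : c ≠ 0) (hs : bracket q ≠ 0)
    (hbq : bracket (b / q) ≠ 0) (hcq : bracket (c / q) ≠ 0) (hx : ∀ i, x i ≠ 0)
    (hy : ∀ i, y i ≠ 0)
    (hD : ∀ i j, kernelDenom (tParam q) (scaledSq q (y j)) (scaledSq q (x i)) ≠ 0)
    (hd : denominatorUU x y ≠ 0) :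
    bracket (q ^ 2) ^ (2 * n) * ZUU2 q b c x y
        / (bracket q ^ (n * (2 * n + 1)) * (bracket (b / q) * bracket (c / q)) ^ n)
      = (∏ i, ∏ j, kernelDenom (tParam q) (scaledSq q (y j)) (scaledSq q (x i)))
        * ((Matrix.of fun i j => kernelUU q b c (scaledSq q (y i)) (scaledSq q (x j))).det
          / ((Matrix.vandermonde fun i => scaledSq q (y i)).det
            * (Matrix.vandermonde fun i => scaledSq q (x i)).det)) := by
  have hdet := det_matrixUU_eq hq hb hc hs hbq hcq hx hy hD
  rw [mul_pow, ← pow_mul] at hdet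
  have hden := denominatorUU_eq hs hx hy
  have hexp : 4 * (n * n) = 2 * (n * (n - 1)) + n + n * (2 * n + 1) := by
    cases n
    · rfl
    · rw [Nat.add_sub_cancel]
      ring
  rw [hden, mul_ne_zero_iff, mul_ne_zero_iff] at hd
  obtain ⟨⟨hxy, -⟩, hV⟩ := hd
  rw [ZUU2, numeratorUU_eq hq hs hx hy, hden, hexp, pow_add, pow_add]
  generalize (∏ i, ∏ j, kernelDenom (tParam q) (scaledSq q (y j)) (scaledSq q (x i))) = D
  have hbc := pow_ne_zero n (mul_ne_zero hbq hcq)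
  rw [div_eq_iff (mul_ne_zero (pow_ne_zero _ hs) hbc), div_mul_eq_mul_div,
    mul_div_assoc', mul_div_assoc', div_mul_eq_mul_div,
    div_eq_div_iff (mul_ne_zero (mul_ne_zero hxy (pow_ne_zero _ hs)) hV) hV]
  linear_combination bracket q ^ (2 * (n * (n - 1))) * bracket q ^ (n * (2 * n + 1)) * D
    * ((Matrix.vandermonde fun i => scaledSq q (y i)).det
            * (Matrix.vandermonde fun i => scaledSq q (x i)).det) * hdet

end PartitionFunction

section SpecializationAtOne

variable {n : ℕ} {q b c : ℂ}

lemma continuousAt_scaledSq (q : ℂ) {w : ℂ} (hw : w ≠ 0) : ContinuousAt (scaledSq q) w :=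
  ((continuousAt_id.sub (continuousAt_inv₀ hw)).div_const _).pow 2

lemma scaledSq_one (q : ℂ) : scaledSq q 1 = 0 := by
  rw [scaledSq, bracket_one, zero_div, zero_pow two_ne_zero]

lemma tendsto_scaledSq_comp (q : ℂ) :
    Tendsto (fun x : Fin n → ℂ => fun i => scaledSq q (x i)) (𝓝 fun _ => 1) (𝓝 0) := by
  refine tendsto_pi_nhds.2 fun i => ?_
  have hscaled := (continuousAt_scaledSq q one_ne_zero).tendsto
  rw [scaledSq_one] at hscaled
  exact hscaled.comp (tendsto_pi_nhds.1 tendsto_id i)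

lemma tendsto_scaledSq_pair (q : ℂ) :
    Tendsto (fun p : (Fin n → ℂ) × (Fin n → ℂ) =>
      ((fun i => scaledSq q (p.2 i), fun i => scaledSq q (p.1 i)) : (Fin n → ℂ) × (Fin n → ℂ)))
      (𝓝 (fun _ => 1, fun _ => 1)) (𝓝 0) :=
  ((tendsto_scaledSq_comp q).comp (continuous_snd.tendsto' _ _ rfl)).prodMk_nhds
    ((tendsto_scaledSq_comp q).comp (continuous_fst.tendsto' _ _ rfl))

lemma eventually_forall_ne_zero :
    ∀ᶠ p : (Fin n → ℂ) × (Fin n → ℂ) in 𝓝 (fun _ => 1, fun _ => 1),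
      (∀ i, p.1 i ≠ 0) ∧ ∀ i, p.2 i ≠ 0 := by
  refine (eventually_all.2 fun i => ?_).and (eventually_all.2 fun i => ?_)
  · exact ContinuousAt.eventually_ne (g := fun p : (Fin n → ℂ) × (Fin n → ℂ) => p.1 i)
      (x := (fun _ => 1, fun _ => 1)) (by fun_prop) one_ne_zero
  · exact ContinuousAt.eventually_ne (g := fun p : (Fin n → ℂ) × (Fin n → ℂ) => p.2 i)
      (x := (fun _ => 1, fun _ => 1)) (by fun_prop) one_ne_zero

lemma tendsto_scaledSq_pair_nhdsWithin (hs : bracket q ≠ 0) :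
    Tendsto (fun p : (Fin n → ℂ) × (Fin n → ℂ) =>
      ((fun i => scaledSq q (p.2 i), fun i => scaledSq q (p.1 i)) : (Fin n → ℂ) × (Fin n → ℂ)))
      (𝓝[{p | denominatorUU p.1 p.2 ≠ 0}] (fun _ => 1, fun _ => 1))
      (𝓝[{p | (Matrix.vandermonde p.1).det * (Matrix.vandermonde p.2).det ≠ 0}] 0) := by
  refine tendsto_nhdsWithin_iff.2 ⟨(tendsto_scaledSq_pair q).mono_left nhdsWithin_le_nhds, ?_⟩
  filter_upwards [nhdsWithin_le_nhds eventually_forall_ne_zero, self_mem_nhdsWithin]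
    with p ⟨hx, hy⟩ hd
  rw [denominatorUU_eq hs hx hy] at hd
  exact right_ne_zero_of_mul hd

lemma eventually_kernelDenom_ne_zero (q : ℂ) :
    ∀ᶠ p : (Fin n → ℂ) × (Fin n → ℂ) in 𝓝 (fun _ => 1, fun _ => 1),
      ∀ i j, kernelDenom (tParam q) (scaledSq q (p.2 j)) (scaledSq q (p.1 i)) ≠ 0 := by
  refine (tendsto_scaledSq_pair q).eventually (p := fun w : (Fin n → ℂ) × (Fin n → ℂ) =>
    ∀ i j, kernelDenom (tParam q) (w.1 j) (w.2 i) ≠ 0)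
    (eventually_all.2 fun i => eventually_all.2 fun j => ?_)
  refine ContinuousAt.eventually_ne
    (g := fun w : (Fin n → ℂ) × (Fin n → ℂ) => kernelDenom (tParam q) (w.1 j) (w.2 i)) ?_ ?_
  · unfold kernelDenom
    fun_prop
  · simp [kernelDenom]

lemma tendsto_prod_kernelDenom (q : ℂ) :
    Tendsto (fun p : (Fin n → ℂ) × (Fin n → ℂ) =>
      ∏ i, ∏ j, kernelDenom (tParam q) (scaledSq q (p.2 j)) (scaledSq q (p.1 i)))
      (𝓝 (fun _ => 1, fun _ => 1)) (𝓝 1) := by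
  have hcont : Continuous fun w : (Fin n → ℂ) × (Fin n → ℂ) =>
      ∏ i, ∏ j, kernelDenom (tParam q) (w.1 j) (w.2 i) := by
    unfold kernelDenom
    fun_prop
  have hlim := (hcont.tendsto 0).comp (tendsto_scaledSq_pair q)
  simpa [kernelDenom, Function.comp_def] using hlim

lemma tendsto_normalized_ZUU2 (hq : q ≠ 0) (hb : b ≠ 0) (hc : c ≠ 0) (hs : bracket q ≠ 0)
    (hbq : bracket (b / q) ≠ 0) (hcq : bracket (c / q) ≠ 0) :
    Tendsto (fun p : (Fin n → ℂ) × (Fin n → ℂ) =>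
        bracket (q ^ 2) ^ (2 * n) * ZUU2 q b c p.1 p.2
          / (bracket q ^ (n * (2 * n + 1)) * (bracket (b / q) * bracket (c / q)) ^ n))
      (𝓝[{p | denominatorUU p.1 p.2 ≠ 0}] (fun _ => 1, fun _ => 1))
      (𝓝 (Matrix.of fun i j : Fin n => kernelCoeff (tParam q)
        (tParam q + (1 + boundaryParam q b) * (1 + boundaryParam q c))
        (tParam q * (1 + boundaryParam q c)) (tParam q * (1 + boundaryParam q b)) (i, j)).det) := by
  have hratio := (tendsto_det_div_det_vandermonde (n := n) (f := kernelUU q b c)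
    (eventually_hasSum_kernelCoeff _ _ _ _)).comp (tendsto_scaledSq_pair_nhdsWithin hs)
  have hlim := ((tendsto_prod_kernelDenom q).mono_left nhdsWithin_le_nhds).mul hratio
  rw [one_mul] at hlim
  refine hlim.congr' ?_
  filter_upwards [nhdsWithin_le_nhds eventually_forall_ne_zero,
    nhdsWithin_le_nhds (eventually_kernelDenom_ne_zero q), self_mem_nhdsWithin]
    with p ⟨hx, hy⟩ hD hd
  exact (normalized_ZUU2_eq hq hb hc hs hbq hcq hx hy hD hd).symm

end SpecializationAtOne

section Uniqueness

open MvPolynomial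

variable {n : ℕ} {q : ℂ}

lemma bracket_exp_ne_zero {r : ℝ} (hr : r ≠ 0) : bracket (Complex.exp r) ≠ 0 := by
  rw [bracket, ← Complex.exp_neg, sub_ne_zero, ← Complex.ofReal_neg, ← Complex.ofReal_exp,
    ← Complex.ofReal_exp, Ne, Complex.ofReal_inj, Real.exp_eq_exp]
  exact self_eq_neg.not.2 hr

lemma denominatorUU_exp_ne_zero {r : ℝ} (hr : r ≠ 0) :
    denominatorUU (fun i : Fin n => Complex.exp (r * (i + 1) : ℝ))
      (fun i : Fin n => Complex.exp (r * (i + 1) : ℝ)) ≠ 0 := by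
  have hdiv {i j : Fin n} (hij : i ≠ j) :
      bracket (Complex.exp (r * (i + 1) : ℝ) / Complex.exp (r * (j + 1) : ℝ)) ≠ 0 := by
    rw [← Complex.exp_sub, ← Complex.ofReal_sub, ← mul_sub, add_sub_add_right_eq_sub]
    refine bracket_exp_ne_zero (mul_ne_zero hr (sub_ne_zero.2 ?_))
    rwa [Ne, Nat.cast_inj, Fin.val_inj]
  have hmul (i j : Fin n) :
      bracket (Complex.exp (r * (i + 1) : ℝ) * Complex.exp (r * (j + 1) : ℝ)) ≠ 0 := by
    rw [← Complex.exp_add, ← Complex.ofReal_add, ← mul_add]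
    exact bracket_exp_ne_zero (mul_ne_zero hr (by positivity))
  refine mul_ne_zero ?_ ?_ <;>
    refine Finset.prod_ne_zero_iff.2 fun i _ => Finset.prod_ne_zero_iff.2 fun j hj => ?_
  · have hij : i ≠ j := (Finset.mem_Ioi.1 hj).ne
    exact mul_ne_zero (hdiv hij.symm) (hdiv hij)
  · rw [one_div, bracket_inv]
    exact mul_ne_zero (neg_ne_zero.2 (hmul i j)) (hmul i j)

lemma neBot_nhdsWithin_denominatorUU_ne_zero :
    (𝓝[{p : (Fin n → ℂ) × (Fin n → ℂ) | denominatorUU p.1 p.2 ≠ 0}]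
      (fun _ => 1, fun _ => 1)).NeBot := by
  let path (r : ℝ) (i : Fin n) : ℂ := Complex.exp (r * (i + 1) : ℝ)
  have hpath : Tendsto path (𝓝[≠] 0) (𝓝 fun _ => 1) := by
    have hcont : Continuous path := by fun_prop
    simpa [path] using (hcont.tendsto 0).mono_left nhdsWithin_le_nhds
  refine Tendsto.neBot (tendsto_nhdsWithin_iff.2 ⟨hpath.prodMk_nhds hpath, ?_⟩)
  filter_upwards [self_mem_nhdsWithin] with r hr
  exact denominatorUU_exp_ne_zero hr

lemma exists_tParam_eq {t : ℂ} (ht : t ≠ 4) :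
    ∃ q : ℂ, q ≠ 0 ∧ bracket q ≠ 0 ∧ tParam q = t := by
  obtain ⟨s, hs⟩ := IsAlgClosed.exists_pow_nat_eq t two_pos
  obtain ⟨d, hd⟩ := IsAlgClosed.exists_pow_nat_eq (t - 4) two_pos
  have hmul : (s + d) / 2 * ((s - d) / 2) = 1 := by linear_combination (hs - hd) / 4
  have hq : (s + d) / 2 ≠ 0 := left_ne_zero_of_mul_eq_one hmul
  have hbracket : bracket ((s + d) / 2) ≠ 0 := by
    have hvalue : bracket ((s + d) / 2) = d := by
      rw [bracket, inv_eq_of_mul_eq_one_right hmul]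
      ring
    rw [hvalue]
    rintro rfl
    exact ht (by linear_combination -hd)
  refine ⟨(s + d) / 2, hq, hbracket, ?_⟩
  rw [tParam_eq hq hbracket, inv_eq_of_mul_eq_one_right hmul]
  linear_combination hs

lemma exists_boundaryParam_eq (hq : q ≠ 0) (hs : bracket q ≠ 0) (ht : tParam q ≠ 0) {y : ℂ}
    (hy : (y + 1) ^ 2 ≠ tParam q * y) :
    ∃ b : ℂ, b ≠ 0 ∧ bracket (b / q) ≠ 0 ∧ boundaryParam q b = y := by
  have hfactor : ((y + 1) ^ 2 - tParam q * y) * q ^ 2 = (y - q ^ 2) * (y * q ^ 2 - 1) := by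
    rw [tParam_eq hq hs]
    field_simp
    ring
  obtain ⟨hden, hnum⟩ := mul_ne_zero_iff.1
    (hfactor ▸ mul_ne_zero (sub_ne_zero.2 hy) (pow_ne_zero 2 hq))
  obtain ⟨b, hb⟩ := IsAlgClosed.exists_pow_nat_eq ((y * q ^ 2 - 1) / (y - q ^ 2)) two_pos
  have hb0 : b ≠ 0 := by
    rintro rfl
    exact div_ne_zero hnum hden (by rw [← hb, zero_pow two_ne_zero])
  rw [eq_div_iff hden] at hb
  have hbq : bracket (b / q) ≠ 0 := by
    intro h
    have hsq : b ^ 2 = q ^ 2 := by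
      rw [bracket, inv_div, sub_eq_zero, div_eq_div_iff hq hb0] at h
      linear_combination h
    rw [tParam_eq hq hs] at ht
    refine mul_ne_zero hs (pow_ne_zero_iff two_ne_zero |>.1 ht) ?_
    rw [bracket]
    field_simp
    linear_combination (y - q ^ 2) * hsq - hb
  refine ⟨b, hb0, hbq, ?_⟩
  rw [boundaryParam, div_eq_iff hbq]
  simp only [bracket]
  field_simp
  linear_combination -hb

/-- A polynomial whose non-vanishing at `(t, y, z)` guarantees that `t, y, z` are the parameters of
some `q, b, c`. -/
def exceptionalPoly : MvPolynomial (Fin 3) ℂ :=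
  X 0 * (X 0 - 4) * ((X 1 + 1) ^ 2 - X 0 * X 1) * ((X 2 + 1) ^ 2 - X 0 * X 2)

lemma exceptionalPoly_ne_zero : exceptionalPoly ≠ 0 := by
  have heval : eval 1 exceptionalPoly ≠ 0 := by
    norm_num [exceptionalPoly]
  intro h
  exact heval (by rw [h, map_zero])

lemma exists_params_eq_of_eval_exceptionalPoly_ne_zero {v : Fin 3 → ℂ}
    (hv : eval v exceptionalPoly ≠ 0) :
    ∃ q b c : ℂ, q ≠ 0 ∧ b ≠ 0 ∧ c ≠ 0 ∧ bracket q ≠ 0 ∧ bracket (b / q) ≠ 0 ∧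
      bracket (c / q) ≠ 0 ∧ ![tParam q, boundaryParam q b, boundaryParam q c] = v := by
  simp only [exceptionalPoly, map_mul, map_sub, map_add, map_pow, map_one, map_ofNat, eval_X,
    mul_ne_zero_iff, sub_ne_zero] at hv
  obtain ⟨⟨⟨ht0, ht4⟩, hy⟩, hz⟩ := hv
  obtain ⟨q, hq, hs, ht⟩ := exists_tParam_eq ht4
  rw [← ht] at ht0 hy hz
  obtain ⟨b, hb, hbq, hby⟩ := exists_boundaryParam_eq hq hs ht0 hy
  obtain ⟨c, hc, hcq, hcz⟩ := exists_boundaryParam_eq hq hs ht0 hz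
  refine ⟨q, b, c, hq, hb, hc, hs, hbq, hcq, ?_⟩
  rw [ht, hby, hcz]
  exact List.ofFn_injective rfl

lemma IsAUU2.unique {P Q : MvPolynomial (Fin 3) ℂ} (hP : IsAUU2 n P) (hQ : IsAUU2 n Q) :
    P = Q := by
  have := neBot_nhdsWithin_denominatorUU_ne_zero (n := n)
  refine mul_left_cancel₀ exceptionalPoly_ne_zero (MvPolynomial.funext fun v => ?_)
  rw [map_mul, map_mul]
  rcases eq_or_ne (eval v exceptionalPoly) 0 with h | h
  · rw [h, zero_mul, zero_mul]
  · obtain ⟨q, b, c, hq, hb, hc, hs, hbq, hcq, rfl⟩ :=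
      exists_params_eq_of_eval_exceptionalPoly_ne_zero h
    rw [tendsto_nhds_unique (hP q b c hq hb hc hs hbq hcq) (hQ q b c hq hb hc hs hbq hcq)]

end Uniqueness

section Determinant

open MvPolynomial

/-- The polynomial `A_UU^(2)(4n; t, y, z)`, as the determinant of the leading Taylor coefficients of
the function to which the entries of `M_UU` reduce. -/
def polyAUU2 (n : ℕ) : MvPolynomial (Fin 3) ℂ :=
  (Matrix.of fun i j : Fin n => kernelCoeff (X 0) (X 0 + (1 + X 1) * (1 + X 2))
    (X 0 * (1 + X 2)) (X 0 * (1 + X 1)) (i, j)).det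

lemma map_kernelCoeff {R S : Type*} [CommRing R] [CommRing S] (φ : R →+* S) (t α β γ : R)
    (p : ℕ × ℕ) : φ (kernelCoeff t α β γ p) = kernelCoeff (φ t) (φ α) (φ β) (φ γ) p := by
  simp only [kernelCoeff, map_sum, map_mul, map_add, map_pow, map_natCast]

lemma isAUU2_polyAUU2 (n : ℕ) : IsAUU2 n (polyAUU2 n) := by
  intro q b c hq hb hc hs hbq hcq
  rw [polyAUU2, RingHom.map_det]
  convert tendsto_normalized_ZUU2 hq hb hc hs hbq hcq
  ext i j
  simp [map_kernelCoeff]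

lemma kernelCoeff_eq_sum_range {R : Type*} [CommRing R] (t α β γ : R) {n : ℕ} (i : Fin n) (j : ℕ) :
    kernelCoeff t α β γ (i, j) = ∑ k ∈ Finset.range n, (α * geomCoeff k k (i, j)
      + β * geomCoeff (k + 1) k (i, j) + γ * geomCoeff k (k + 1) (i, j)) * t ^ k := by
  refine Finset.sum_subset (Finset.range_mono i.is_lt) fun k _ hk => ?_
  have hik : (i : ℕ) < k := by simpa using hk
  rw [geomCoeff_eq_zero_of_lt hik, geomCoeff_eq_zero_of_lt (by simp; omega),
    geomCoeff_eq_zero_of_lt hik]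
  simp

lemma polyAUU2_eq (n : ℕ) : polyAUU2 n = Matrix.det (Matrix.of fun i j : Fin n =>
    ∑ k ∈ Finset.range n,
      ((X 0 + (1 + X 1) * (1 + X 2)) * (Nat.choose (i + j) (i + k) : MvPolynomial (Fin 3) ℂ)
          * (Nat.choose (i + k) (2 * k) : MvPolynomial (Fin 3) ℂ) * X 0 ^ k
        + ((1 + X 2) * (Nat.choose (i + j) (i + k) : MvPolynomial (Fin 3) ℂ)
              * (Nat.choose (i + k) (2 * k + 1) : MvPolynomial (Fin 3) ℂ)
            + (1 + X 1) * (Nat.choose (i + j) (i + k + 1) : MvPolynomial (Fin 3) ℂ)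
              * (Nat.choose (i + k + 1) (2 * k + 1) : MvPolynomial (Fin 3) ℂ))
          * X 0 ^ (k + 1))) := by
  refine congrArg Matrix.det (Matrix.ext fun i j => ?_)
  simp only [Matrix.of_apply, kernelCoeff_eq_sum_range]
  refine Finset.sum_congr rfl fun k _ => ?_
  have hαk : geomCoeff k k (i, j) = (i + j : ℕ).choose (i + k) * (i + k : ℕ).choose (2 * k) := by
    grind [geomCoeff]
  have hβk : geomCoeff (k + 1) k (i, j)
      = (i + j : ℕ).choose (i + k) * (i + k : ℕ).choose (2 * k + 1) := by
    grind [geomCoeff]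
  have hγk : geomCoeff k (k + 1) (i, j)
      = (i + j : ℕ).choose (i + k + 1) * (i + k + 1 : ℕ).choose (2 * k + 1) := by
    grind [geomCoeff]
  rw [hαk, hβk, hγk]
  push_cast
  ring

end Determinant

end KuperbergUU

end

open KuperbergUU

theorem mainTheorem7 (n : ℕ) (P : MvPolynomial (Fin 3) ℂ) (t y z : MvPolynomial (Fin 3) ℂ)
    (ht : t = MvPolynomial.X 0) (hy : y = MvPolynomial.X 1) (hz : z = MvPolynomial.X 2) :
    KuperbergUU.IsAUU2 n P ↔
      P = Matrix.det (Matrix.of fun i j : Fin n =>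
        ∑ k ∈ Finset.range n,
          ((t + (1 + y) * (1 + z))
              * (Nat.choose (i + j) (i + k) : MvPolynomial (Fin 3) ℂ)
              * (Nat.choose (i + k) (2 * k) : MvPolynomial (Fin 3) ℂ) * t ^ k
            + ((1 + z) * (Nat.choose (i + j) (i + k) : MvPolynomial (Fin 3) ℂ)
                  * (Nat.choose (i + k) (2 * k + 1) : MvPolynomial (Fin 3) ℂ)
                + (1 + y) * (Nat.choose (i + j) (i + k + 1) : MvPolynomial (Fin 3) ℂ)
                  * (Nat.choose (i + k + 1) (2 * k + 1) : MvPolynomial (Fin 3) ℂ))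
              * t ^ (k + 1))) := by
  subst ht hy hz
  rw [← polyAUU2_eq]
  refine ⟨fun hP => hP.unique (isAUU2_polyAUU2 n), ?_⟩
  rintro rfl
  exact isAUU2_polyAUU2 n
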